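/- Let $N\ge 1$, let $\|\cdot\|_a$ be a norm on $\mathbb{R}^N$ that is monotone on the nonnegative orthant (that is, $0\le y\le x$ entrywise implies $\|y\|_a\le\|x\|_a$), and let $T=(t^{(1)},\dots,t^{(N)}):\mathbb{R}_+^N\to\mathbb{R}_{++}^N$ be continuous and concave (with respect to the entrywise order), where $\mathbb{R}_+=[0,\infty)$ and $\mathbb{R}_{++}=(0,\infty)$. For a power budget $\bar p>0$ consider the problem $$\text{maximize } c\quad\text{subject to}\quad p=cT(p),\quad \|p\|_a\le\bar p,\quad p\in\mathbb{R}_+^N,\ c\in\mathbb{R}_{++}.$$ For every $\bar p>0$ this problem has a unique solution $(P(\bar p),U(\bar p))\in\mathbb{R}_{++}^N\times\mathbb{R}_{++}$, and $U:\mathbb{R}_{++}\to\mathbb{R}_{++}$ is called the utility function. Let $M\in\mathbb{R}_+^{N\times N}$ be the lower bounding matrix of $T$, whose entries are $M_{i,j}=\lim_{h\to0^+}h\,t^{(i)}(h^{-1}e_j)$ (these limits exist), where $e_j$ is the $j$th standard unit vector, and let $\rho(M)$ be its spectral radius. Extend each $t^{(i)}$ by $-\infty$ outside $\mathbb{R}_+^N$,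 and denote by $t^{(i)}_\infty(y):=\lim_{h\to\infty}\bigl(t^{(i)}(x+hy)-t^{(i)}(x)\bigr)/h$, with $x\in\mathbb{R}_+^N$ arbitrary, its recession (asymptotic) function. Let $\mathbf 1$ be the all-ones vector and $p_\infty:=(t^{(1)}_\infty(\mathbf 1),\dots,t^{(N)}_\infty(\mathbf 1))$; these limits exist, are finite and do not depend on $x$. Then: (i) $U(\bar p)\le \bar p/\|T(0)\|_a$ for every $\bar p>0$. If $\rho(M)>0$, then also $U(\bar p)<1/\rho(M)$ for every $\bar p>0$. (ii) If $\rho(M)>0$ and $u:=\|T(0)\|_a/\rho(M)$, then for every $\bar p>0$ $$U(\bar p)\le\begin{cases}1/\rho(M)&\text{if }\bar p\ge u,\\ \bar p/\|T(0)\|_a&\text{otherwise.}\end{cases}$$ (iii) Let $\beta>0$ satisfy $\|p\|_\infty\le\beta\|p\|_a$ for every $p\in\mathbb{R}_{++}^N$. Then $U(\bar p)\ge \bar p/\|T(\bar p\,\beta\,\mathbf 1)\|_a$ for every $\bar p>0$. (iv) The limit $c_\infty:=\lim_{\bar p\to\infty}U(\bar p)$ exists in $(0,\infty]$, and for every $\beta$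 as in (iii) $$c_\infty\ge\begin{cases}\dfrac{1}{\beta\|p_\infty\|_a}&\text{if }\|p_\infty\|_a>0,\\ \infty&\text{otherwise.}\end{cases}$$ -/

import Mathlib

open Filter Topology

/-- A norm `a` on `ℝ^N` (a seminorm that vanishes only at `0`) that is monotone on the
nonnegative orthant. -/
structure IsMonotoneNorm {N : ℕ} (a : Seminorm ℝ (Fin N → ℝ)) : Prop where
  eq_zero_of_norm_eq_zero : ∀ x, a x = 0 → x = 0
  monotone : ∀ x y : Fin N → ℝ, 0 ≤ y → y ≤ x → a y ≤ a x

/-- `T` restricts to a continuous concave mapping from the nonnegative orthant to the set of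
vectors with positive entries.  Only the values of `T` on the nonnegative orthant `Set.Ici 0`
matter; the order on `Fin N → ℝ` is the entrywise one. -/
structure IsInterferenceMapping {N : ℕ} (T : (Fin N → ℝ) → (Fin N → ℝ)) : Prop where
  pos : ∀ x, 0 ≤ x → ∀ i, 0 < T x i
  continuousOn : ContinuousOn T (Set.Ici 0)
  concaveOn : ConcaveOn ℝ (Set.Ici 0) T

/-- The constraints of the canonical problem with power budget `pbar`. -/
def IsFeasible {N : ℕ} (T : (Fin N → ℝ) → (Fin N → ℝ)) (a : Seminorm ℝ (Fin N → ℝ)) (pbar : ℝ)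
    (p : Fin N → ℝ) (c : ℝ) : Prop :=
  0 ≤ p ∧ 0 < c ∧ p = c • T p ∧ a p ≤ pbar

/-- `(p, c)` solves the canonical problem: it is feasible and maximizes `c`. -/
def IsSolution {N : ℕ} (T : (Fin N → ℝ) → (Fin N → ℝ)) (a : Seminorm ℝ (Fin N → ℝ)) (pbar : ℝ)
    (p : Fin N → ℝ) (c : ℝ) : Prop :=
  IsFeasible T a pbar p c ∧ ∀ q d, IsFeasible T a pbar q d → d ≤ c

/-- The utility function `U`: the component `c` of the solution `(p, c)` of the canonical
problem with power budget `pbar`. -/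
noncomputable def utility {N : ℕ} (T : (Fin N → ℝ) → (Fin N → ℝ)) (a : Seminorm ℝ (Fin N → ℝ))
    (pbar : ℝ) : ℝ :=
  Classical.epsilon fun c => ∃ p, IsSolution T a pbar p c

/-- `M` is the matrix with entries `lim_{h → 0+} h t_i(h⁻¹ e_j)` (in particular all these limits
exist). -/
def IsLowerBoundingMatrix {N : ℕ} (T : (Fin N → ℝ) → (Fin N → ℝ))
    (M : Matrix (Fin N) (Fin N) ℝ) : Prop :=
  ∀ i j, Tendsto (fun h : ℝ => h * T (h⁻¹ • (Pi.single j 1 : Fin N → ℝ)) i) (𝓝[>] 0) (𝓝 (M i j))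

/-- The lower bounding matrix of `T`. -/
noncomputable def lowerBoundingMatrix {N : ℕ} (T : (Fin N → ℝ) → (Fin N → ℝ)) :
    Matrix (Fin N) (Fin N) ℝ :=
  Matrix.of fun i j =>
    limUnder (𝓝[>] (0 : ℝ)) fun h : ℝ => h * T (h⁻¹ • (Pi.single j 1 : Fin N → ℝ)) i

/-- The spectral radius of a real square matrix: the largest modulus of its complex
eigenvalues. -/
noncomputable def matrixSpectralRadius {N : ℕ} (M : Matrix (Fin N) (Fin N) ℝ) : ℝ :=
  (spectralRadius ℂ (M.map (fun r : ℝ => (r : ℂ)))).toReal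

/-- `l` is the value at `y` of the recession (asymptotic) function of `f : ℝ^N → ℝ ∪ {-∞}`:
for every `x` in the effective domain of `f`, `(f (x + h y) - f x) / h → l` as `h → ∞`. -/
def IsRecessionValue {N : ℕ} (f : (Fin N → ℝ) → EReal) (y : Fin N → ℝ) (l : EReal) : Prop :=
  ∀ x, f x ≠ ⊥ → Tendsto (fun h : ℝ => (f (x + h • y) - f x) / (h : EReal)) atTop (𝓝 l)

/-- The recession (asymptotic) function of `f`. -/
noncomputable def recessionFunction {N : ℕ} (f : (Fin N → ℝ) → EReal) (y : Fin N → ℝ) : EReal :=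
  Classical.epsilon fun l => IsRecessionValue f y l

open Classical in
/-- The `i`-th component of `T`, as a function on all of `ℝ^N` with the value `-∞` outside the
nonnegative orthant. -/
noncomputable def extendedComponent {N : ℕ} (T : (Fin N → ℝ) → (Fin N → ℝ)) (i : Fin N)
    (x : Fin N → ℝ) : EReal :=
  if 0 ≤ x then (T x i : EReal) else ⊥

/-- The vector of the recession functions of the components of `T`, evaluated at the all-ones
vector. -/
noncomputable def recessionVector {N : ℕ} (T : (Fin N → ℝ) → (Fin N → ℝ)) : Fin N → ℝ :=
  fun i => (recessionFunction (extendedComponent T i) 1).toReal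

/-! Positivity turns concavity of `T` into monotonicity (`mono`) and strict subhomogeneity
(`map_smul_lt`). Hence `p = c T(p)` has at most one solution for each `c`, and any supersolution `c
T(x) ≤ x` lies above one (`exists_fixed_le`). Compactness then gives an optimum. Upper bounds: a
feasible `p` satisfies `p = c T(p) ≥ c T(0)`, and more precisely `p ≥ c (T(0) + M p)` by
`add_mulVec_le`. The first yields the norm bound; the second makes `p` strictly subinvariant for
`M`, which bounds `ρ(M)`. Lower bounds: with `y = pbar β 1` and `c = pbar / a (T y)`, the vector `c
T(y)` is a supersolution of norm `pbar` (`div_le_utility`). Letting `pbar → ∞` turns the denominator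
into the recession vector. -/

namespace IsInterferenceMapping

variable {N : ℕ} {T : (Fin N → ℝ) → (Fin N → ℝ)}

/-! ### Order properties and fixed points of concave positive mappings. -/

theorem combo_le (hT : IsInterferenceMapping T) {x y : Fin N → ℝ} (hx : 0 ≤ x) (hy : 0 ≤ y)
    {s t : ℝ} (hs : 0 ≤ s) (ht : 0 ≤ t) (hst : s + t = 1) (i : Fin N) :
    s * T x i + t * T y i ≤ T (s • x + t • y) i :=
  hT.concaveOn.2 hx hy hs ht hst i

/-- If a component decreased from `x` to `y`, its concave upper bound along the ray would reach zero
further out, contradicting positivity there. -/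
theorem mono (hT : IsInterferenceMapping T) {x y : Fin N → ℝ} (hx : 0 ≤ x) (hxy : x ≤ y) :
    T x ≤ T y := by
  intro i
  by_contra! h
  have hxp := hT.pos x hx i
  have hyp := hT.pos y (hx.trans hxy) i
  -- Chosen so that `(1 - s) * T x i = T y i`: the chord from `x` through `y` vanishes at `x + s⁻¹ •
  -- (y - x)`.
  set s : ℝ := (T x i - T y i) / T x i with hs
  have hs0 : 0 < s := div_pos (by linarith) hxp
  have hs1 : s ≤ 1 := by rw [hs, div_le_one hxp]; linarith
  have hz : 0 ≤ x + s⁻¹ • (y - x) :=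
    add_nonneg hx (smul_nonneg (inv_nonneg.2 hs0.le) (sub_nonneg.2 hxy))
  have key := hT.combo_le hx hz (sub_nonneg.2 hs1) hs0.le (by ring) i
  have e : (1 - s) • x + s • (x + s⁻¹ • (y - x)) = y := by
    ext j
    simp
    field_simp
    ring
  rw [e] at key
  have h1 : (1 - s) * T x i = T y i := by rw [hs]; field_simp; ring
  have h2 := mul_pos hs0 (hT.pos _ hz i)
  linarith

theorem nonneg (hT : IsInterferenceMapping T) {x : Fin N → ℝ} (hx : 0 ≤ x) : 0 ≤ T x :=
  fun i => (hT.pos x hx i).le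

theorem map_smul_lt (hT : IsInterferenceMapping T) {x : Fin N → ℝ} (hx : 0 ≤ x) {r : ℝ}
    (hr : 1 < r) (i : Fin N) : T (r • x) i < r * T x i := by
  have hr0 : 0 < r := by linarith
  have key := hT.combo_le (smul_nonneg hr0.le hx) le_rfl (inv_nonneg.2 hr0.le)
    (sub_nonneg.2 (inv_le_one_of_one_le₀ hr.le)) (by ring) i
  have h2 : 0 < (1 - r⁻¹) * T 0 i :=
    mul_pos (sub_pos.2 (inv_lt_one_of_one_lt₀ hr)) (hT.pos 0 le_rfl i)
  have e : r⁻¹ • r • x + (1 - r⁻¹) • (0 : Fin N → ℝ) = x := by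
    rw [smul_zero, add_zero, inv_smul_smul₀ hr0.ne']
  rw [e] at key
  have h3 : r⁻¹ * T (r • x) i < T x i := by linarith
  rwa [inv_mul_lt_iff₀ hr0] at h3

theorem continuous_sup_zero (hT : IsInterferenceMapping T) : Continuous fun x => T (x ⊔ 0) :=
  hT.continuousOn.comp_continuous
    (continuous_pi fun i => (continuous_apply i).max continuous_const)
    fun x => show 0 ≤ x ⊔ 0 from le_sup_right

/-- A supersolution of `p = c T(p)` dominates a solution. -/
theorem exists_fixed_le (hT : IsInterferenceMapping T) {x : Fin N → ℝ} {c : ℝ} (hc : 0 < c)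
    (hx : 0 ≤ x) (h : c • T x ≤ x) : ∃ p, 0 ≤ p ∧ p ≤ x ∧ p = c • T p := by
  -- Replacing `y` by `y ⊔ 0` makes the map continuous on the whole space without changing it on the
  -- orthant. A supersolution with minimal coordinate sum is fixed, since `c • T p` is a smaller
  -- one.
  have hK : IsCompact (Set.Icc 0 x ∩ {y | c • T (y ⊔ 0) ≤ y}) :=
    isCompact_Icc.inter_right
      (isClosed_le (hT.continuous_sup_zero.const_smul c) continuous_id)
  obtain ⟨p, ⟨⟨hp0, hpx⟩, hp⟩, hmin⟩ := hK.exists_isMinOn (f := fun y => ∑ i, y i)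
    ⟨x, ⟨hx, le_rfl⟩, by simpa [sup_eq_left.2 hx] using h⟩
    (continuous_finsetSum _ fun i _ => continuous_apply i).continuousOn
  simp only [Set.mem_ofPred_eq, sup_eq_left.2 hp0] at hp
  have hq0 : 0 ≤ c • T p := smul_nonneg hc.le (hT.nonneg hp0)
  have hq := hmin (show c • T p ∈ _ from ⟨⟨hq0, hp.trans hpx⟩, by
    simpa [sup_eq_left.2 hq0] using smul_le_smul_of_nonneg_left (hT.mono hq0 hp) hc.le⟩)
  refine ⟨p, hp0, hpx, ?_⟩
  have := (Finset.sum_eq_sum_iff_of_le fun i _ => hp i).1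
    (le_antisymm (Finset.sum_le_sum fun i _ => hp i) hq)
  ext i
  exact (this i (Finset.mem_univ i)).symm

/-- Take the least `r` with `p ≤ r q`. If `r > 1`, strict subhomogeneity contradicts equality in the
coordinate where `p i = r * q i`. -/
theorem fixed_le (hT : IsInterferenceMapping T) {p q : Fin N → ℝ} {c : ℝ} (hc : 0 < c)
    (hp : 0 ≤ p) (hq : 0 ≤ q) (hpc : p = c • T p) (hqc : q = c • T q) : p ≤ q := by
  rcases isEmpty_or_nonempty (Fin N) with hN | hN
  · exact fun i => hN.elim i
  have hqpos : ∀ i, 0 < q i := fun i => by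
    rw [hqc]; exact mul_pos hc (hT.pos q hq i)
  obtain ⟨i, hi⟩ := Finite.exists_max fun i => p i / q i
  have hle : p ≤ (p i / q i) • q := fun j => (div_le_iff₀ (hqpos j)).1 (hi j)
  by_contra hcon
  have hr : 1 < p i / q i := by
    by_contra! hr
    refine hcon fun j => (hle j).trans ?_
    simpa using mul_le_mul_of_nonneg_right hr (hq j)
  have h1 : p i ≤ c * T ((p i / q i) • q) i := by
    conv_lhs => rw [hpc]
    exact mul_le_mul_of_nonneg_left (hT.mono hp hle i) hc.le
  have h2 := mul_lt_mul_of_pos_left (hT.map_smul_lt hq hr i) hc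
  have h3 : c * (p i / q i * T q i) = p i := by
    have : q i = c * T q i := congrFun hqc i
    have h4 := hqpos i
    calc c * (p i / q i * T q i) = p i / q i * (c * T q i) := by ring
      _ = p i := by rw [← this]; field_simp
  linarith

theorem fixed_unique (hT : IsInterferenceMapping T) {p q : Fin N → ℝ} {c : ℝ} (hc : 0 < c)
    (hp : 0 ≤ p) (hq : 0 ≤ q) (hpc : p = c • T p) (hqc : q = c • T q) : p = q :=
  le_antisymm (hT.fixed_le hc hp hq hpc hqc) (hT.fixed_le hc hq hp hqc hpc)

/-! ### Limits along rays: lower bounding matrix and recession vector. -/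

/-- `s ↦ T(s y) / s` has a finite limit at infinity. -/
theorem exists_tendsto_ray (hT : IsInterferenceMapping T) {y : Fin N → ℝ} (hy : 0 ≤ y)
    (i : Fin N) :
    ∃ l, 0 ≤ l ∧ Tendsto (fun h : ℝ => h * T (h⁻¹ • y) i) (𝓝[>] 0) (𝓝 l) := by
  have hnn : ∀ h : ℝ, 0 < h → 0 ≤ h * T (h⁻¹ • y) i := fun h hh =>
    mul_nonneg hh.le (hT.nonneg (smul_nonneg (inv_nonneg.2 hh.le) hy) i)
  have hmono : MonotoneOn (fun h : ℝ => h * T (h⁻¹ • y) i) (Set.Ioi 0) := by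
    intro h hh k hk hhk
    rcases hhk.eq_or_lt with rfl | hlt
    · rfl
    have hh : 0 < h := hh
    have hk : 0 < k := hk
    have key := hT.map_smul_lt (smul_nonneg (inv_nonneg.2 hk.le) hy) ((one_lt_div hh).2 hlt) i
    have e : (k / h) • k⁻¹ • y = h⁻¹ • y := by
      rw [smul_smul]; congr 1; field_simp
    rw [e] at key
    calc h * T (h⁻¹ • y) i ≤ h * (k / h * T (k⁻¹ • y) i) :=
          mul_le_mul_of_nonneg_left key.le hh.le
      _ = k * T (k⁻¹ • y) i := by field_simp
  have hlim := hmono.tendsto_nhdsGT ⟨0, by rintro _ ⟨h, hh, rfl⟩; exact hnn h hh⟩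
  exact ⟨_, ge_of_tendsto hlim (eventually_nhdsWithin_of_forall fun h hh => hnn h hh), hlim⟩

theorem isLowerBoundingMatrix (hT : IsInterferenceMapping T) :
    IsLowerBoundingMatrix T (lowerBoundingMatrix T) := by
  intro i j
  obtain ⟨l, -, hl⟩ := hT.exists_tendsto_ray (y := Pi.single j 1)
    (Pi.single_nonneg.2 zero_le_one) i
  exact tendsto_nhds_limUnder ⟨l, hl⟩

theorem lowerBoundingMatrix_nonneg (hT : IsInterferenceMapping T) (i j : Fin N) :
    0 ≤ lowerBoundingMatrix T i j := by
  obtain ⟨l, hl0, hl⟩ := hT.exists_tendsto_ray (y := Pi.single j 1)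
    (Pi.single_nonneg.2 zero_le_one) i
  rwa [tendsto_nhds_unique (hT.isLowerBoundingMatrix i j) hl]

/-- Write `x` as the convex combination of the points `h⁻¹ e_j` with weights `h * x j` and of `0`
with the remaining weight, apply Jensen, and let `h → 0+`. -/
theorem add_mulVec_le (hT : IsInterferenceMapping T) {x : Fin N → ℝ} (hx : 0 ≤ x) (i : Fin N) :
    T 0 i + ∑ j, lowerBoundingMatrix T i j * x j ≤ T x i := by
  have hlim : Tendsto (fun h : ℝ => (1 - h * ∑ j, x j) * T 0 i +
      ∑ j, x j * (h * T (h⁻¹ • (Pi.single j 1 : Fin N → ℝ)) i)) (𝓝[>] 0)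
      (𝓝 ((1 - 0 * ∑ j, x j) * T 0 i + ∑ j, x j * lowerBoundingMatrix T i j)) := by
    have h0 : Tendsto (fun h : ℝ => h) (𝓝[>] 0) (𝓝 0) := tendsto_nhdsWithin_of_tendsto_nhds
      tendsto_id
    exact ((tendsto_const_nhds.sub (h0.mul_const _)).mul_const _).add
      (tendsto_finsetSum _ fun j _ => (hT.isLowerBoundingMatrix i j).const_mul _)
  have hsum : 0 ≤ ∑ j, x j := Finset.sum_nonneg fun j _ => hx j
  have hev : ∀ᶠ h : ℝ in 𝓝[>] 0, (1 - h * ∑ j, x j) * T 0 i +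
      ∑ j, x j * (h * T (h⁻¹ • (Pi.single j 1 : Fin N → ℝ)) i) ≤ T x i := by
    have hlt : ∀ᶠ h : ℝ in 𝓝[>] 0, h < (∑ j, x j + 1)⁻¹ :=
      eventually_nhdsWithin_of_eventually_nhds (gt_mem_nhds (by positivity))
    filter_upwards [hlt, self_mem_nhdsWithin] with h hh hh0
    have hh0 : 0 < h := hh0
    have h1 : h * ∑ j, x j ≤ 1 := by
      rw [lt_inv_comm₀ hh0 (by positivity)] at hh
      have := mul_lt_mul_of_pos_left hh hh0
      rw [mul_inv_cancel₀ hh0.ne'] at this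
      nlinarith
    have key := hT.concaveOn.map_add_sum_le (t := Finset.univ) (v := 1 - h * ∑ j, x j)
      (w := fun j => h * x j) (q := 0) (p := fun j => h⁻¹ • (Pi.single j 1 : Fin N → ℝ))
      (fun j _ => mul_nonneg hh0.le (hx j)) (by rw [← Finset.mul_sum]; ring)
      (fun j _ => Set.mem_Ici.2 <|
        smul_nonneg (inv_nonneg.2 hh0.le) (Pi.single_nonneg.2 zero_le_one))
      (sub_nonneg.2 h1) (Set.self_mem_Ici)
    have e : (1 - h * ∑ j, x j) • (0 : Fin N → ℝ) +
        ∑ j, (h * x j) • h⁻¹ • (Pi.single j 1 : Fin N → ℝ) = x := by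
      ext k
      simp [Finset.sum_apply, Pi.single_apply]
      field_simp
    rw [e] at key
    have key := key i
    simp only [Pi.add_apply, Pi.smul_apply, Finset.sum_apply, smul_eq_mul] at key
    refine le_trans (le_of_eq ?_) key
    congr 1
    exact Finset.sum_congr rfl fun j _ => by ring
  have := le_of_tendsto hlim hev
  simpa [mul_comm] using this

/-- The limit of `T(h 1) / h` gives the recession function at `1` for every base point. -/
theorem isRecessionValue (hT : IsInterferenceMapping T) {i : Fin N} {l : ℝ}
    (hl : Tendsto (fun h : ℝ => T (h • (1 : Fin N → ℝ)) i / h) atTop (𝓝 l)) :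
    IsRecessionValue (extendedComponent T i) 1 (l : EReal) := by
  intro x hx
  have hx0 : 0 ≤ x := by
    by_contra h
    exact hx (if_neg h)
  have h1 : (0 : Fin N → ℝ) ≤ 1 := zero_le_one
  have hreal : Tendsto (fun h : ℝ => (T (x + h • (1 : Fin N → ℝ)) i - T x i) / h) atTop
      (𝓝 l) := by
    have hzero : Tendsto (fun h : ℝ => T x i / h) atTop (𝓝 0) :=
      tendsto_const_nhds.div_atTop tendsto_id
    -- Squeeze by monotonicity: `h 1 ≤ x + h 1 ≤ (‖x‖ + h) 1`, so the base point does not affect the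
    -- limit.
    have hup : Tendsto (fun h : ℝ => T ((‖x‖ + h) • (1 : Fin N → ℝ)) i / (‖x‖ + h) *
        (1 + ‖x‖ / h)) atTop (𝓝 (l * (1 + 0))) :=
      (hl.comp (tendsto_atTop_add_const_left _ _ tendsto_id)).mul
        (tendsto_const_nhds.add (tendsto_const_nhds.div_atTop tendsto_id))
    have hsq : Tendsto (fun h : ℝ => T (x + h • (1 : Fin N → ℝ)) i / h) atTop (𝓝 l) := by
      refine tendsto_of_tendsto_of_tendsto_of_le_of_le' hl (by simpa using hup) ?_ ?_
      · filter_upwards [eventually_gt_atTop 0] with h hh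
        gcongr
        exact hT.mono (smul_nonneg hh.le h1) (le_add_of_nonneg_left hx0) i
      · filter_upwards [eventually_gt_atTop 0] with h hh
        have hle : T (x + h • (1 : Fin N → ℝ)) i ≤ T ((‖x‖ + h) • (1 : Fin N → ℝ)) i := by
          refine hT.mono (add_nonneg hx0 (smul_nonneg hh.le h1)) (fun j => ?_) i
          have := (le_abs_self _).trans (norm_le_pi_norm x j)
          simpa using this
        have hpos : 0 < ‖x‖ + h := by positivity
        calc _ ≤ T ((‖x‖ + h) • (1 : Fin N → ℝ)) i / h := by gcongr
          _ = _ := by field_simp; ring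
    simpa [sub_div] using hsq.sub hzero
  refine (continuous_coe_real_ereal.continuousAt.tendsto.comp hreal).congr' ?_
  filter_upwards [eventually_ge_atTop 0] with h hh
  have hxh : 0 ≤ x + h • (1 : Fin N → ℝ) := add_nonneg hx0 (smul_nonneg hh h1)
  simp only [extendedComponent, if_pos hxh, if_pos hx0, Function.comp_apply, EReal.coe_div,
    EReal.coe_sub]

theorem tendsto_recessionVector (hT : IsInterferenceMapping T) (i : Fin N) :
    Tendsto (fun h : ℝ => T (h • (1 : Fin N → ℝ)) i / h) atTop (𝓝 (recessionVector T i)) ∧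
      IsRecessionValue (extendedComponent T i) 1 (recessionVector T i : EReal) := by
  obtain ⟨l, -, hl⟩ := hT.exists_tendsto_ray (y := 1) zero_le_one i
  have hl' : Tendsto (fun h : ℝ => T (h • (1 : Fin N → ℝ)) i / h) atTop (𝓝 l) := by
    refine (hl.comp tendsto_inv_atTop_nhdsGT_zero).congr fun h => ?_
    simp [div_eq_inv_mul]
  have hrec := hT.isRecessionValue hl'
  have heps : IsRecessionValue (extendedComponent T i) 1
      (recessionFunction (extendedComponent T i) 1) := Classical.epsilon_spec ⟨_, hrec⟩
  have h0 : extendedComponent T i 0 ≠ ⊥ := by simp [extendedComponent]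
  have heq : recessionVector T i = l := by
    rw [recessionVector, tendsto_nhds_unique (heps 0 h0) (hrec 0 h0), EReal.toReal_coe]
  rw [heq]
  exact ⟨hl', hrec⟩

end IsInterferenceMapping

/-! ### Spectral radius and monotone norms. -/

/-- A subinvariant positive vector of a nonnegative matrix bounds its spectral radius. -/
theorem matrixSpectralRadius_le {N : ℕ} {M : Matrix (Fin N) (Fin N) ℝ} (hM : ∀ i j, 0 ≤ M i j)
    {p : Fin N → ℝ} (hp : ∀ i, 0 < p i) {r : ℝ} (hr : 0 ≤ r)
    (h : ∀ i, ∑ j, M i j * p j ≤ r * p i) : matrixSpectralRadius M ≤ r := by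
  refine ENNReal.toReal_le_of_le_ofReal hr (iSup₂_le fun μ hμ => ?_)
  have hle : ‖μ‖ ≤ r := by
    rw [spectrum.mem_iff, Matrix.isUnit_iff_isUnit_det, isUnit_iff_ne_zero, not_not,
      ← Matrix.exists_mulVec_eq_zero_iff] at hμ
    obtain ⟨v, hv0, hv⟩ := hμ
    have heig : ∀ i, μ * v i = ∑ j, (M i j : ℂ) * v j := fun i => by
      have := congrFun hv i
      rw [Matrix.sub_mulVec, Algebra.algebraMap_eq_smul_one, Matrix.smul_mulVec,
        Matrix.one_mulVec] at this
      simpa [Matrix.mulVec, dotProduct, sub_eq_zero] using this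
    obtain ⟨k, hk⟩ := Function.ne_iff.1 hv0
    have : Nonempty (Fin N) := ⟨k⟩
    -- Compare the eigenvector with `p` in the row where the `p`-weighted sup norm of `v` is
    -- attained.
    obtain ⟨i, hi⟩ := Finite.exists_max fun i => ‖v i‖ / p i
    have hvi : 0 < ‖v i‖ / p i := (div_pos (norm_pos_iff.2 hk) (hp k)).trans_le (hi k)
    have hle : ∀ j, ‖v j‖ ≤ ‖v i‖ / p i * p j := fun j => (div_le_iff₀ (hp j)).1 (hi j)
    have hvi' : 0 < ‖v i‖ := (div_pos_iff_of_pos_right (hp i)).1 hvi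
    have : ‖μ‖ * ‖v i‖ ≤ r * ‖v i‖ := by
      calc ‖μ‖ * ‖v i‖ = ‖∑ j, (M i j : ℂ) * v j‖ := by rw [← norm_mul, heig]
        _ ≤ ∑ j, M i j * ‖v j‖ := (norm_sum_le _ _).trans_eq <|
            Finset.sum_congr rfl fun j _ => by
              rw [norm_mul, Complex.norm_real, Real.norm_of_nonneg (hM i j)]
        _ ≤ ∑ j, M i j * (‖v i‖ / p i * p j) :=
            Finset.sum_le_sum fun j _ => mul_le_mul_of_nonneg_left (hle j) (hM i j)
        _ = ‖v i‖ / p i * ∑ j, M i j * p j := by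
            rw [Finset.mul_sum]
            exact Finset.sum_congr rfl fun j _ => by ring
        _ ≤ ‖v i‖ / p i * (r * p i) := mul_le_mul_of_nonneg_left (h i) hvi.le
        _ = r * ‖v i‖ := by have := (hp i).ne'; field_simp
    exact le_of_mul_le_mul_right this hvi'
  exact (ENNReal.ofReal_le_ofReal hle).trans' (ofReal_norm μ).ge

namespace IsMonotoneNorm

variable {N : ℕ} {a : Seminorm ℝ (Fin N → ℝ)}

theorem pos (ha : IsMonotoneNorm a) {x : Fin N → ℝ} (hx : x ≠ 0) : 0 < a x :=
  (apply_nonneg a x).lt_of_ne' fun h => hx (ha.eq_zero_of_norm_eq_zero x h)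

theorem pos_of_pos (ha : IsMonotoneNorm a) (hN : 0 < N) {x : Fin N → ℝ} (hx : ∀ i, 0 < x i) :
    0 < a x :=
  ha.pos fun h => by simpa [h] using hx ⟨0, hN⟩

theorem apply_le (ha : IsMonotoneNorm a) {p : Fin N → ℝ} (hp : 0 ≤ p) (i : Fin N) :
    p i ≤ a p / a (Pi.single i 1) := by
  have hpos : 0 < a (Pi.single i 1) := ha.pos (by simp)
  rw [le_div_iff₀ hpos]
  have h1 : p i • (Pi.single i 1 : Fin N → ℝ) ≤ p := by
    intro j
    rcases eq_or_ne j i with rfl | hj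
    · simp
    · simpa [hj] using hp j
  have h2 := ha.monotone p (p i • Pi.single i 1)
    (smul_nonneg (hp i) (Pi.single_nonneg.2 zero_le_one)) h1
  rwa [map_smul_eq_mul, Real.norm_of_nonneg (hp i)] at h2

end IsMonotoneNorm

theorem Seminorm.continuous_of_pi {N : ℕ} (a : Seminorm ℝ (Fin N → ℝ)) : Continuous a :=
  continuousOn_univ.1 (ConvexOn.continuousOn isOpen_univ a.convexOn)

/-! ### Existence, uniqueness and bounds for the utility. -/

section Utility

variable {N : ℕ} {T : (Fin N → ℝ) → (Fin N → ℝ)} {a : Seminorm ℝ (Fin N → ℝ)} {pbar : ℝ}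

theorem IsFeasible.pos (hT : IsInterferenceMapping T) {p : Fin N → ℝ} {c : ℝ}
    (h : IsFeasible T a pbar p c) (i : Fin N) : 0 < p i := by
  obtain ⟨hp, hc, hpc, -⟩ := h
  rw [hpc]
  exact mul_pos hc (hT.pos p hp i)

theorem IsFeasible.le_div (hN : 0 < N) (hT : IsInterferenceMapping T) (ha : IsMonotoneNorm a)
    {p : Fin N → ℝ} {c : ℝ} (h : IsFeasible T a pbar p c) : c ≤ pbar / a (T 0) := by
  obtain ⟨hp, hc, hpc, hpa⟩ := h
  rw [le_div_iff₀ (ha.pos_of_pos hN (hT.pos 0 le_rfl))]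
  calc c * a (T 0) ≤ c * a (T p) := mul_le_mul_of_nonneg_left
        (ha.monotone _ _ (hT.nonneg le_rfl) (hT.mono le_rfl hp)) hc.le
    _ = a (c • T p) := by rw [map_smul_eq_mul, Real.norm_of_nonneg hc.le]
    _ ≤ pbar := by rwa [← hpc]

theorem exists_isFeasible_of_supersolution (hT : IsInterferenceMapping T)
    (ha : IsMonotoneNorm a) {x : Fin N → ℝ} {c : ℝ} (hc : 0 < c) (hx : 0 ≤ x)
    (h : c • T x ≤ x) (hax : a x ≤ pbar) : ∃ p, IsFeasible T a pbar p c := by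
  obtain ⟨p, hp, hpx, hpc⟩ := hT.exists_fixed_le hc hx h
  exact ⟨p, hp, hc, hpc, (ha.monotone _ _ hp hpx).trans hax⟩

theorem exists_isFeasible (hN : 0 < N) (hT : IsInterferenceMapping T) (ha : IsMonotoneNorm a)
    (hpbar : 0 < pbar) : ∃ p c, IsFeasible T a pbar p c := by
  have h1 : 0 < a 1 := ha.pos_of_pos hN fun _ => one_pos
  set x : Fin N → ℝ := (pbar / a 1) • 1 with hxdef
  have hs : 0 < pbar / a 1 := div_pos hpbar h1
  have hx : 0 ≤ x := smul_nonneg hs.le zero_le_one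
  have hTx : 0 < ‖T x‖ := norm_pos_iff.2 fun h => by
    have := hT.pos x hx ⟨0, hN⟩
    simp [h] at this
  suffices h : ∃ p, IsFeasible T a pbar p (pbar / a 1 / ‖T x‖) from
    h.imp fun p hp => ⟨_, hp⟩
  refine exists_isFeasible_of_supersolution hT ha (div_pos hs hTx) hx (fun i => ?_) ?_
  · have h2 : T x i ≤ ‖T x‖ := (le_abs_self _).trans (norm_le_pi_norm (T x) i)
    calc pbar / a 1 / ‖T x‖ * T x i ≤ pbar / a 1 / ‖T x‖ * ‖T x‖ := by gcongr
      _ = x i := by rw [div_mul_cancel₀ _ hTx.ne']; simp [hxdef]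
  · rw [hxdef, map_smul_eq_mul, Real.norm_of_nonneg hs.le, div_mul_cancel₀ _ h1.ne']

theorem exists_isSolution (hN : 0 < N) (hT : IsInterferenceMapping T) (ha : IsMonotoneNorm a)
    (hpbar : 0 < pbar) : ∃ p c, IsSolution T a pbar p c := by
  obtain ⟨p₀, c₀, h₀⟩ := exists_isFeasible hN hT ha hpbar
  have hc₀ : 0 < c₀ := h₀.2.1
  -- Requiring `c ≥ c₀` replaces the open condition `c > 0`, making the set closed without losing
  -- any better candidate.
  set K : Set ((Fin N → ℝ) × ℝ) :=
    (Set.Icc 0 (fun i => pbar / a (Pi.single i 1)) ×ˢ Set.Icc c₀ (pbar / a (T 0))) ∩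
      ({x | x.1 = x.2 • T (x.1 ⊔ 0)} ∩ {x | a x.1 ≤ pbar}) with hKdef
  have hK : IsCompact K := (isCompact_Icc.prod isCompact_Icc).inter_right <|
    (isClosed_eq continuous_fst
      (continuous_snd.smul (hT.continuous_sup_zero.comp continuous_fst))).inter
    (isClosed_le (a.continuous_of_pi.comp continuous_fst) continuous_const)
  have hmem : ∀ p c, IsFeasible T a pbar p c → c₀ ≤ c → (p, c) ∈ K := by
    intro p c h hc
    refine ⟨⟨⟨h.1, fun i => (ha.apply_le h.1 i).trans ?_⟩, hc, h.le_div hN hT ha⟩, ?_, h.2.2.2⟩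
    · exact div_le_div_of_nonneg_right h.2.2.2 (apply_nonneg a _)
    · simpa [sup_eq_left.2 h.1] using h.2.2.1
  obtain ⟨⟨p, c⟩, ⟨⟨hp, hc⟩, hpc, hpa⟩, hmax⟩ :=
    hK.exists_isMaxOn ⟨_, hmem p₀ c₀ h₀ le_rfl⟩ continuous_snd.continuousOn
  have hp0 : 0 ≤ p := hp.1
  have hc0 : c₀ ≤ c := hc.1
  refine ⟨p, c, ⟨hp0, hc₀.trans_le hc0, ?_, hpa⟩, fun q d hq => ?_⟩
  · simpa [sup_eq_left.2 hp0] using hpc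
  · rcases le_total c₀ d with hd | hd
    · exact hmax (hmem q d hq hd)
    · exact hd.trans hc0

theorem isSolution_utility (hN : 0 < N) (hT : IsInterferenceMapping T) (ha : IsMonotoneNorm a)
    (hpbar : 0 < pbar) : ∃ p, IsSolution T a pbar p (utility T a pbar) := by
  obtain ⟨p, c, h⟩ := exists_isSolution hN hT ha hpbar
  exact Classical.epsilon_spec (p := fun c => ∃ p, IsSolution T a pbar p c) ⟨c, p, h⟩

theorem IsFeasible.le_utility (hN : 0 < N) (hT : IsInterferenceMapping T)
    (ha : IsMonotoneNorm a) (hpbar : 0 < pbar) {p : Fin N → ℝ} {c : ℝ}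
    (h : IsFeasible T a pbar p c) : c ≤ utility T a pbar := by
  obtain ⟨q, hq⟩ := isSolution_utility hN hT ha hpbar
  exact hq.2 p c h

theorem isSolution_unique (hT : IsInterferenceMapping T) {p q : Fin N → ℝ} {c d : ℝ}
    (hp : IsSolution T a pbar p c) (hq : IsSolution T a pbar q d) : p = q ∧ c = d := by
  obtain rfl : c = d := le_antisymm (hq.2 _ _ hp.1) (hp.2 _ _ hq.1)
  exact ⟨hT.fixed_unique hp.1.2.1 hp.1.1 hq.1.1 hp.1.2.2.1 hq.1.2.2.1, rfl⟩

theorem utility_mono (hN : 0 < N) (hT : IsInterferenceMapping T) (ha : IsMonotoneNorm a)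
    {r s : ℝ} (hr : 0 < r) (hrs : r ≤ s) : utility T a r ≤ utility T a s := by
  obtain ⟨p, hp⟩ := isSolution_utility hN hT ha hr
  obtain ⟨h1, h2, h3, h4⟩ := hp.1
  exact IsFeasible.le_utility hN hT ha (hr.trans_le hrs) ⟨h1, h2, h3, h4.trans hrs⟩

theorem IsFeasible.lt_inv_matrixSpectralRadius (hN : 0 < N) (hT : IsInterferenceMapping T)
    {p : Fin N → ℝ} {c : ℝ} (h : IsFeasible T a pbar p c)
    (hρ : 0 < matrixSpectralRadius (lowerBoundingMatrix T)) :
    c < 1 / matrixSpectralRadius (lowerBoundingMatrix T) := by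
  have hpos := h.pos hT
  obtain ⟨hp, hc, hpc, -⟩ := h
  have : Nonempty (Fin N) := ⟨⟨0, hN⟩⟩
  obtain ⟨k, hk⟩ := Finite.exists_max fun i =>
    (∑ j, lowerBoundingMatrix T i j * p j) / p i
  -- The inequality is strict because `T 0 k > 0`.
  have hlt : (∑ j, lowerBoundingMatrix T k j * p j) / p k < 1 / c := by
    rw [div_lt_div_iff₀ (hpos k) hc]
    have h1 := hT.add_mulVec_le hp k
    have h2 := hT.pos 0 le_rfl k
    have h3 : p k = c * T p k := congrFun hpc k
    nlinarith
  have hle := matrixSpectralRadius_le hT.lowerBoundingMatrix_nonneg hpos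
    (div_nonneg (Finset.sum_nonneg fun j _ =>
      mul_nonneg (hT.lowerBoundingMatrix_nonneg k j) (hp j)) (hp k))
    fun i => (div_le_iff₀ (hpos i)).1 (hk i)
  rw [lt_one_div hc hρ]
  exact hle.trans_lt hlt

theorem div_le_utility (hN : 0 < N) (hT : IsInterferenceMapping T) (ha : IsMonotoneNorm a)
    {β : ℝ} (hβ : 0 < β) (h : ∀ p : Fin N → ℝ, (∀ i, 0 < p i) → ‖p‖ ≤ β * a p)
    (hpbar : 0 < pbar) :
    pbar / a (T ((pbar * β) • (1 : Fin N → ℝ))) ≤ utility T a pbar := by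
  set y : Fin N → ℝ := (pbar * β) • 1 with hydef
  have hy : 0 ≤ y := smul_nonneg (by positivity) zero_le_one
  have hay : 0 < a (T y) := ha.pos_of_pos hN (hT.pos y hy)
  set c := pbar / a (T y) with hcdef
  have hc : 0 < c := div_pos hpbar hay
  have hx : 0 ≤ c • T y := smul_nonneg hc.le (hT.nonneg hy)
  have hax : a (c • T y) = pbar := by
    rw [map_smul_eq_mul, Real.norm_of_nonneg hc.le, hcdef, div_mul_cancel₀ _ hay.ne']
  -- Here `β` enters: a positive vector with `a`-norm `pbar` has entries at most `pbar * β`.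
  -- Monotonicity then makes `c • T y` a supersolution.
  have hxy : c • T y ≤ y := fun i => by
    have h1 := h (c • T y) fun i => mul_pos hc (hT.pos y hy i)
    have h2 := (le_abs_self _).trans (norm_le_pi_norm (c • T y) i)
    rw [hax] at h1
    simpa [hydef, mul_comm β] using h2.trans h1
  obtain ⟨p, hp⟩ := exists_isFeasible_of_supersolution hT ha hc hx
    (smul_le_smul_of_nonneg_left (hT.mono hx hxy) hc.le) hax.le
  exact hp.le_utility hN hT ha hpbar

/-! ### Behaviour for large budgets. -/

theorem exists_tendsto_utility (hN : 0 < N) (hT : IsInterferenceMapping T)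
    (ha : IsMonotoneNorm a) : ∃ cinf : EReal,
      Tendsto (fun pbar : ℝ => (utility T a pbar : EReal)) atTop (𝓝 cinf) := by
  -- Monotonicity is known only for positive budgets; truncation at `1` makes it global.
  have hmono : Monotone fun s : ℝ => (utility T a (max s 1) : EReal) := fun r s hrs =>
    EReal.coe_le_coe_iff.2 <| utility_mono hN hT ha (by positivity) (max_le_max_right 1 hrs)
  refine ⟨_, (tendsto_atTop_iSup hmono).congr' ?_⟩
  filter_upwards [eventually_ge_atTop 1] with s hs
  rw [max_eq_left hs]

theorem tendsto_norm_ray (hT : IsInterferenceMapping T) {β : ℝ} (hβ : 0 < β) :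
    Tendsto (fun s : ℝ => a (T ((s * β) • (1 : Fin N → ℝ))) / s) atTop
      (𝓝 (β * a (recessionVector T))) := by
  have hvec : Tendsto (fun h : ℝ => h⁻¹ • T (h • (1 : Fin N → ℝ))) atTop
      (𝓝 (recessionVector T)) :=
    tendsto_pi_nhds.2 fun i => (hT.tendsto_recessionVector i).1.congr fun h => by
      simp [div_eq_inv_mul]
  refine ((((a.continuous_of_pi.tendsto _).comp hvec).comp
    (tendsto_id.atTop_mul_const hβ)).const_mul β).congr' ?_
  filter_upwards [eventually_gt_atTop 0] with s hs
  have : 0 ≤ (s * β)⁻¹ := by positivity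
  simp only [Function.comp_apply, id, map_smul_eq_mul, Real.norm_of_nonneg this]
  field_simp

theorem le_limit_utility (hN : 0 < N) (hT : IsInterferenceMapping T) (ha : IsMonotoneNorm a)
    {cinf : EReal}
    (hlim : Tendsto (fun pbar : ℝ => (utility T a pbar : EReal)) atTop (𝓝 cinf))
    {β : ℝ} (hβ : 0 < β) (h : ∀ p : Fin N → ℝ, (∀ i, 0 < p i) → ‖p‖ ≤ β * a p) :
    (if 0 < a (recessionVector T) then ((1 / (β * a (recessionVector T)) : ℝ) : EReal)
      else ⊤) ≤ cinf := by
  have hray := tendsto_norm_ray (a := a) hT hβ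
  have hbound : ∀ᶠ s : ℝ in atTop,
      (a (T ((s * β) • (1 : Fin N → ℝ))) / s)⁻¹ ≤ utility T a s := by
    filter_upwards [eventually_gt_atTop 0] with s hs
    rw [inv_div]
    exact div_le_utility hN hT ha hβ h hs
  split_ifs with hpos
  · have hinv := hray.inv₀ (mul_pos hβ hpos).ne'
    rw [one_div]
    exact le_of_tendsto_of_tendsto (continuous_coe_real_ereal.continuousAt.tendsto.comp hinv)
      hlim (hbound.mono fun s hs => EReal.coe_le_coe_iff.2 hs)
  · have hzero : a (recessionVector T) = 0 := le_antisymm (not_lt.1 hpos) (apply_nonneg a _)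
    rw [hzero, mul_zero] at hray
    -- The ratio tends to `0` through positive values, so its inverse, a lower bound for the
    -- utility, diverges.
    have hinf := tendsto_atTop_mono' _ hbound <| tendsto_inv_nhdsGT_zero.comp <|
      tendsto_nhdsWithin_of_tendsto_nhds_of_eventually_within _ hray <| by
        filter_upwards [eventually_gt_atTop 0] with s hs
        exact div_pos (ha.pos_of_pos hN (hT.pos _ (smul_nonneg (by positivity) zero_le_one))) hs
    exact (tendsto_nhds_unique (EReal.tendsto_coe_atTop.comp hinf) hlim).le

end Utility

theorem mainTheorem2 {N : ℕ} (hN : 0 < N) (T : (Fin N → ℝ) → (Fin N → ℝ))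
    (hT : IsInterferenceMapping T) (a : Seminorm ℝ (Fin N → ℝ)) (ha : IsMonotoneNorm a) :
    -- the objects below are well defined: the canonical problem has exactly one solution, whose
    -- second component is `utility`, and the limits defining the lower bounding matrix and the
    -- recession functions at the all-ones vector exist
    (∀ pbar : ℝ, 0 < pbar → 0 < utility T a pbar ∧ ∃ p : Fin N → ℝ, (∀ i, 0 < p i) ∧
      ∀ q c, IsSolution T a pbar q c ↔ q = p ∧ c = utility T a pbar) ∧
    IsLowerBoundingMatrix T (lowerBoundingMatrix T) ∧
    (∀ i, IsRecessionValue (extendedComponent T i) 1 (recessionVector T i : EReal)) ∧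
    -- (i) upper bounds
    (∀ pbar : ℝ, 0 < pbar → utility T a pbar ≤ pbar / a (T 0)) ∧
    (0 < matrixSpectralRadius (lowerBoundingMatrix T) →
      ∀ pbar : ℝ, 0 < pbar →
        utility T a pbar < 1 / matrixSpectralRadius (lowerBoundingMatrix T)) ∧
    -- (ii) combined upper bound
    (0 < matrixSpectralRadius (lowerBoundingMatrix T) →
      ∀ pbar : ℝ, 0 < pbar →
        utility T a pbar ≤
          if a (T 0) / matrixSpectralRadius (lowerBoundingMatrix T) ≤ pbar then
            1 / matrixSpectralRadius (lowerBoundingMatrix T)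
          else pbar / a (T 0)) ∧
    -- (iii) lower bound; `‖p‖` is the sup norm
    (∀ β : ℝ, 0 < β → (∀ p : Fin N → ℝ, (∀ i, 0 < p i) → ‖p‖ ≤ β * a p) →
      ∀ pbar : ℝ, 0 < pbar →
        pbar / a (T ((pbar * β) • (1 : Fin N → ℝ))) ≤ utility T a pbar) ∧
    -- (iv) asymptotic lower bound
    (∃ cinf : EReal, Tendsto (fun pbar : ℝ => (utility T a pbar : EReal)) atTop (𝓝 cinf) ∧
      ∀ β : ℝ, 0 < β → (∀ p : Fin N → ℝ, (∀ i, 0 < p i) → ‖p‖ ≤ β * a p) →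
        (if 0 < a (recessionVector T) then ((1 / (β * a (recessionVector T)) : ℝ) : EReal)
          else ⊤) ≤ cinf) := by
  have hi : ∀ pbar : ℝ, 0 < pbar → utility T a pbar ≤ pbar / a (T 0) := fun pbar hpbar => by
    obtain ⟨p, hp⟩ := isSolution_utility hN hT ha hpbar
    exact hp.1.le_div hN hT ha
  have hρ : 0 < matrixSpectralRadius (lowerBoundingMatrix T) → ∀ pbar : ℝ, 0 < pbar →
      utility T a pbar < 1 / matrixSpectralRadius (lowerBoundingMatrix T) :=
    fun h pbar hpbar => by
      obtain ⟨p, hp⟩ := isSolution_utility hN hT ha hpbar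
      exact hp.1.lt_inv_matrixSpectralRadius hN hT h
  refine ⟨fun pbar hpbar => ?_, hT.isLowerBoundingMatrix,
    fun i => (hT.tendsto_recessionVector i).2, hi, hρ, fun h pbar hpbar => ?_,
    fun β hβ h pbar hpbar => div_le_utility hN hT ha hβ h hpbar, ?_⟩
  · obtain ⟨p, hp⟩ := isSolution_utility hN hT ha hpbar
    refine ⟨hp.1.2.1, p, hp.1.pos hT, fun q c => ⟨fun hq => isSolution_unique hT hq hp, ?_⟩⟩
    rintro ⟨rfl, rfl⟩
    exact hp
  · split_ifs
    · exact (hρ h pbar hpbar).le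
    · exact hi pbar hpbar
  · obtain ⟨cinf, hlim⟩ := exists_tendsto_utility hN hT ha
    exact ⟨cinf, hlim, fun β hβ h => le_limit_utility hN hT ha hlim hβ h⟩
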